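/- Let $W$ be a real vector space of dimension $n+1$ with dual $W^*$, let $R\in W$, and let $P\subset W^*$ be a (nonempty) simple convex polytope of dimension $n$ contained in the hyperplane $\mathcal H=\{\eta\in W^* : \langle \eta,R\rangle =1\}$, i.e. $P$ is the convex hull of a finite set, $P$ affinely spans $\mathcal H$, and exactly $n$ edges of $P$ emanate from each vertex. Let $C=\{r\eta : \eta\in P,\ r\ge 0\}$ be the cone over $P$ and $C^\circ$ its interior in $W^*$. For each vertex $p$ of $P$ let $E_p$ be the set of edge vectors of $P$ at $p$ (one vector pointing from $p$ along each edge at $p$; they lie in $\mathcal H_0=\{\eta : \langle\eta,R\rangle=0\}$ and only their directions matter), and let $\mu_p$ be a vector generating the edge $\mathbb R_{\ge 0}\,p$ of $C$ (for instance the primitive lattice vector on this edge, if the edge is rational). Let $\xi\in \mathcal H_0^*$ be a polarizing vector for $P$, i.e. $\langle w,\xi\rangle\ne 0$ for every edge vector $w$ of $P$, and put $E_p^{\pm}(\xi)=\{w\in E_p : \pm\langle w,\xi\rangle>0\}$, $$C_p^\#=p+\sum_{w\in E_p^+(\xi)}\mathbb R_{<0}\,w+\sum_{w\in E_p^-(\xi)}\mathbb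 R_{\ge 0}\,w,\qquad \check C_p^\#=p+\sum_{w\in E_p^+(\xi)}\mathbb R_{>0}\,w+\sum_{w\in E_p^-(\xi)}\mathbb R_{\le 0}\,w,$$ $$K_p^\#=C_p^\#+\mathbb R\mu_p,\qquad \check K_p^\#=\check C_p^\#+\mathbb R\mu_p .$$ Then for every $x\in W^*$ $$\sum_{p\in \mathrm{Vert}(P)}(-1)^{|E_p^+(\xi)|}\,\mathbf 1_{K_p^\#}(x)=\mathbf 1_C(x)+(-1)^n\,\mathbf 1_{-C^\circ}(x),$$ $$\sum_{p\in \mathrm{Vert}(P)}(-1)^{|E_p^+(\xi)|}\,\mathbf 1_{\check K_p^\#}(x)=(-1)^n\,\mathbf 1_{C^\circ}(x)+\mathbf 1_{-C}(x).$$ Moreover, let $\mathbb Z_W\subset W$ be the integral lattice spanned by a basis of $W$, let $\mathbb Z_W^*\subset W^*$ be its dual lattice, and for $A\subset W^*$ let $A(x)=\sum_{\mu\in A\cap \mathbb Z_W^*}x^\mu$ denote the generating series of $A$, a formal series with exponents in $\mathbb Z_W^*$. Then $$\sum_{p\in \mathrm{Vert}(P)}(-1)^{|E_p^+(\xi)|}\,K_p^\#(x)=C(x)+(-1)^n\,(-C^\circ)(x),$$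 $$\sum_{p\in \mathrm{Vert}(P)}(-1)^{|E_p^+(\xi)|}\,\check K_p^\#(x)=(-1)^n\,C^\circ(x)+(-C)(x).$$ In particular this applies to $W^*=V^*\times\mathbb R^*$ and $P\times\{1^*\}$ for a simple convex polytope $P$ of full dimension in an $n$-dimensional space $V^*$. -/

import Mathlib

open Set
open scoped Pointwise

namespace PolarCone

noncomputable section

/-! Throughout, `E` is a finite-dimensional real vector space in the role of `W^*`; its dual
`Module.Dual ℝ E` is then the space `W`, and the pairing `⟨η, v⟩` of `η : E` with
`v : Module.Dual ℝ E` is `v η`. -/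

variable {E : Type*} [AddCommGroup E] [Module ℝ E]

/-- The vertices of `P`. -/
def Vert (P : Set E) : Set E := P.extremePoints ℝ

/-- The edge vectors `w` of `P` emanating from the vertex `p`: one vector for each edge `[p, q]`
of `P` at `p` (a face of `P` that is a segment joining `p` to another vertex `q`), normalised to
be `q - p`. -/
def edgeVectors [TopologicalSpace E] (P : Set E) (p : E) : Set E :=
  {w | ∃ q ∈ Vert P, q ≠ p ∧ IsExposed ℝ P (segment ℝ p q) ∧ w = q - p}

/-- A (nonempty) convex polytope: the convex hull of a nonempty finite set. -/
def IsPolytope (P : Set E) : Prop :=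
  ∃ s : Set E, s.Finite ∧ s.Nonempty ∧ P = convexHull ℝ s

/-- `P` is a simple convex polytope of dimension `n` on the `n`-dimensional hyperplane
`⟨η, R⟩ = 1`: it spans that hyperplane, and exactly `n` edges emanate from each vertex. -/
structure IsSimplePolytopeOn [TopologicalSpace E] (R : Module.Dual ℝ E) (n : ℕ) (P : Set E) :
    Prop where
  isPolytope : IsPolytope P
  affineSpan_eq : (affineSpan ℝ P : Set E) = {η | R η = 1}
  ncard_edgeVectors : ∀ p ∈ Vert P, (edgeVectors P p).ncard = n

/-- The cone over `P`. -/
def coneOver (P : Set E) : Set E :=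
  {x | ∃ r : ℝ, 0 ≤ r ∧ ∃ η ∈ P, x = r • η}

section Polarization

variable [TopologicalSpace E] {R : Module.Dual ℝ E}

/-- `ξ`, a functional on the space `ker R` of directions of the hyperplane `⟨η, R⟩ = 1`, is a
polarizing vector for `P`: it does not vanish on any edge vector. -/
def IsPolarizing (P : Set E) (ξ : Module.Dual ℝ (LinearMap.ker R)) : Prop :=
  ∀ p ∈ Vert P, ∀ w : LinearMap.ker R, (w : E) ∈ edgeVectors P p → ξ w ≠ 0

/-- `E_p^+(ξ)`. -/
def edgePlus (P : Set E) (ξ : Module.Dual ℝ (LinearMap.ker R)) (p : E) :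
    Set (LinearMap.ker R) :=
  {w | (w : E) ∈ edgeVectors P p ∧ 0 < ξ w}

/-- `E_p^-(ξ)`. -/
def edgeMinus (P : Set E) (ξ : Module.Dual ℝ (LinearMap.ker R)) (p : E) :
    Set (LinearMap.ker R) :=
  {w | (w : E) ∈ edgeVectors P p ∧ ξ w < 0}

/-- The sign `(-1)^{|E_p^+(ξ)|}`. -/
def vertexSign (P : Set E) (ξ : Module.Dual ℝ (LinearMap.ker R)) (p : E) : ℤ :=
  (-1) ^ (edgePlus P ξ p).ncard

/-- The polarized tangent cone
`C_p^# = p + ∑_{w ∈ E_p^+} ℝ_{<0} w + ∑_{w ∈ E_p^-} ℝ_{≥0} w`. -/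
def polarizedCone (P : Set E) (ξ : Module.Dual ℝ (LinearMap.ker R)) (p : E) : Set E :=
  {x | ∃ a : LinearMap.ker R → ℝ,
    (∀ w ∈ edgePlus P ξ p, a w < 0) ∧ (∀ w ∈ edgeMinus P ξ p, 0 ≤ a w) ∧
    x = p + ∑ᶠ w ∈ edgePlus P ξ p, a w • (w : E) + ∑ᶠ w ∈ edgeMinus P ξ p, a w • (w : E)}

/-- The dual polarized tangent cone
`Č_p^# = p + ∑_{w ∈ E_p^+} ℝ_{>0} w + ∑_{w ∈ E_p^-} ℝ_{≤0} w`. -/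
def dualPolarizedCone (P : Set E) (ξ : Module.Dual ℝ (LinearMap.ker R)) (p : E) : Set E :=
  {x | ∃ a : LinearMap.ker R → ℝ,
    (∀ w ∈ edgePlus P ξ p, 0 < a w) ∧ (∀ w ∈ edgeMinus P ξ p, a w ≤ 0) ∧
    x = p + ∑ᶠ w ∈ edgePlus P ξ p, a w • (w : E) + ∑ᶠ w ∈ edgeMinus P ξ p, a w • (w : E)}

/-- `K_p^# = C_p^# + ℝ μ`, where `μ` is the edge vector of the cone through `p`. -/
def liftedCone (P : Set E) (ξ : Module.Dual ℝ (LinearMap.ker R)) (p μ : E) : Set E :=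
  {x | ∃ y ∈ polarizedCone P ξ p, ∃ t : ℝ, x = y + t • μ}

/-- `Ǩ_p^# = Č_p^# + ℝ μ`, where `μ` is the edge vector of the cone through `p`. -/
def dualLiftedCone (P : Set E) (ξ : Module.Dual ℝ (LinearMap.ker R)) (p μ : E) : Set E :=
  {x | ∃ y ∈ dualPolarizedCone P ξ p, ∃ t : ℝ, x = y + t • μ}

end Polarization

/-- The integral lattice `ℤ_W` of `W` with respect to a basis of `W`. -/
def integralLattice {ι : Type*} (b : Module.Basis ι ℝ (Module.Dual ℝ E)) :
    Submodule ℤ (Module.Dual ℝ E) :=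
  Submodule.span ℤ (Set.range b)

/-- The dual `ℤ_W^*` of the integral lattice: the `η ∈ W^*` that pair integrally with it. -/
def dualLattice {ι : Type*} (b : Module.Basis ι ℝ (Module.Dual ℝ E)) : AddSubgroup E where
  carrier := {η | ∀ v ∈ integralLattice b, ∃ k : ℤ, v η = k}
  zero_mem' := fun v _ => ⟨0, by simp⟩
  add_mem' := by
    intro x y hx hy v hv
    obtain ⟨k, hk⟩ := hx v hv
    obtain ⟨l, hl⟩ := hy v hv
    exact ⟨k + l, by rw [map_add, hk, hl]; push_cast; ring⟩
  neg_mem' := by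
    intro x hx v hv
    obtain ⟨k, hk⟩ := hx v hv
    exact ⟨-k, by rw [map_neg, hk]; push_cast; ring⟩

/-- `μ` is an edge vector of the cone over `P` through the vertex `p`, i.e. it generates the ray
through `p`. -/
def IsEdgeVector (p μ : E) : Prop := ∃ c : ℝ, 0 < c ∧ μ = c • p

/-- `μ` is the primitive edge vector through `p`: an edge vector that lies in the lattice and is
not a proper integral multiple of a lattice vector. -/
def IsPrimitiveEdgeVector {ι : Type*} (b : Module.Basis ι ℝ (Module.Dual ℝ E)) (p μ : E) :
    Prop :=
  IsEdgeVector p μ ∧ μ ∈ dualLattice b ∧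
    ∀ (k : ℕ) (u : E), u ∈ dualLattice b → μ = k • u → k = 1

/-- A primitive edge vector is in particular an edge vector. -/
theorem IsPrimitiveEdgeVector.isEdgeVector {ι : Type*}
    {b : Module.Basis ι ℝ (Module.Dual ℝ E)} {p μ : E} (h : IsPrimitiveEdgeVector b p μ) :
    IsEdgeVector p μ :=
  h.1

/-- Formal series `∑_μ c_μ x^μ` with integer coefficients, `μ` running over the whole lattice
`ℤ_W^*`. -/
abbrev FormalSeries {ι : Type*} (b : Module.Basis ι ℝ (Module.Dual ℝ E)) : Type _ :=
  dualLattice b → ℤ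

open Classical in
/-- The monomial `x^μ`. -/
def monomial {ι : Type*} (b : Module.Basis ι ℝ (Module.Dual ℝ E)) (μ : dualLattice b) :
    FormalSeries b :=
  Pi.single μ 1

/-- The generating series `A(x) = ∑_{μ ∈ A ∩ ℤ_W^*} x^μ`, given by its coefficients. -/
def genSeries {ι : Type*} (b : Module.Basis ι ℝ (Module.Dual ℝ E)) (A : Set E) :
    FormalSeries b :=
  fun μ => A.indicator 1 (μ : E)

/-- `genSeries b A` is the sum of the monomials `x^μ` over the lattice points of `A`
(coefficientwise convergence). -/
theorem hasSum_genSeries {ι : Type*} (b : Module.Basis ι ℝ (Module.Dual ℝ E)) (A : Set E) :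
    HasSum (fun μ : {μ : dualLattice b // (μ : E) ∈ A} => monomial b μ.1) (genSeries b A) := by
  classical
  rw [Pi.hasSum]
  intro ν
  by_cases hν : (ν : E) ∈ A
  · have h := hasSum_single (f := fun μ : {μ : dualLattice b // (μ : E) ∈ A} =>
      monomial b μ.1 ν) ⟨ν, hν⟩ (by
        intro μ hμ
        have : ν ≠ μ.1 := fun h => hμ (Subtype.ext h.symm)
        simp [monomial, this])
    simpa [genSeries, monomial, hν] using h
  · have h0 : (fun μ : {μ : dualLattice b // (μ : E) ∈ A} => monomial b μ.1 ν) = 0 := by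
      funext μ
      have : ν ≠ μ.1 := fun h => hν (h ▸ μ.2)
      simp [monomial, this]
    have h1 : genSeries b A ν = 0 := by simp [genSeries, hν]
    rw [h0, h1]
    exact hasSum_zero

/-- A polytope has finitely many vertices, so that sums over them are honest finite sums. -/
theorem IsPolytope.finite_vert {P : Set E} (hP : IsPolytope P) : (Vert P).Finite := by
  obtain ⟨s, hs, -, rfl⟩ := hP
  exact hs.subset extremePoints_convexHull_subset

/-- A polytope has finitely many edge vectors at each vertex. -/
theorem IsPolytope.finite_edgeVectors [TopologicalSpace E] {P : Set E} (hP : IsPolytope P)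
    (p : E) : (edgeVectors P p).Finite :=
  (hP.finite_vert.image fun q => q - p).subset fun _ ⟨q, hq, _, _, hw⟩ => ⟨q, hq, hw.symm⟩

end

end PolarCone

namespace PolarCone

/-! Extend `ξ` to a functional `f` on `E`. A simple polytope has a functional for each facet,
nonnegative on `P`; those at a vertex `p` are dual, up to scaling, to the edges at `p`. In these
coordinates `x` lies in the lifted cone at `p` iff the facets through `p` that are negative at `x`
are exactly those opposite to the edges along which `f` increases (`mem_liftedCone_iff`). So the
left-hand side at `x` depends only on `f` and on the set `A` of facets negative at `x`: it is
`signedCount f A`.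

The key point is that `signedCount f A` does not depend on the generic `f`. Each nonempty face has a
unique vertex where `f` is maximal, and grouping faces by that vertex turns the count into the sum
of `(-1)^|J|` over all `J ⊆ A` that cut out a nonempty face (`signedCount_eq_sum_face`), which does
not mention `f`.

Hence `f` may be chosen to suit `x`. If `x` is in the cone, then `A` is empty and the count is `1`.
If `-x` is in its interior, then `A` is everything, and reversing `f` gives `(-1)^n`. Otherwise some
functional satisfies `f x > R x * f p` at every vertex `p`, and then no vertex contributes
(`signedCount_eq_zero`). The dual identity is the first one at `-x`, and the series identities are
the pointwise ones read at lattice points. -/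

/-- A finite-dimensional Hausdorff real topological vector space is locally convex. -/
theorem locallyConvexSpace_of_finiteDimensional (E : Type*) [AddCommGroup E] [Module ℝ E]
    [FiniteDimensional ℝ E] [TopologicalSpace E] [IsTopologicalAddGroup E] [ContinuousSMul ℝ E]
    [T2Space E] : LocallyConvexSpace ℝ E := by
  let e : E ≃L[ℝ] (Fin (Module.finrank ℝ E) → ℝ) :=
    ContinuousLinearEquiv.ofFinrankEq (by simp)
  have h := LocallyConvexSpace.induced (𝕜 := ℝ) e.toLinearEquiv.toLinearMap
  have h2 : ‹TopologicalSpace E› =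
      TopologicalSpace.induced e.toLinearEquiv.toLinearMap
        inferInstance := e.toHomeomorph.isInducing.eq_induced
  rw [h2]
  exact h

/-! ### Polytopes: exposed vertices, separation, tangent cones. -/

section Polytope

variable {E : Type*} [AddCommGroup E] [Module ℝ E]

/-- A point of the convex hull of a finite set `s` at which a functional attains its minimum over
`s` lies in the convex hull of the minimizers in `s`. -/
theorem mem_convexHull_of_minimal {s : Set E} (hs : s.Finite) (g : Module.Dual ℝ E) {m : ℝ}
    (hg : ∀ v ∈ s, m ≤ g v) {x : E} (hx : x ∈ convexHull ℝ s) (hxm : g x ≤ m) :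
    x ∈ convexHull ℝ {v ∈ s | g v = m} := by
  classical
  obtain ⟨s, rfl⟩ := hs.exists_finset_coe
  obtain ⟨a, ha, ha1, rfl⟩ := Finset.mem_convexHull'.1 hx
  have hzero : ∀ v ∈ s, a v * (g v - m) = 0 := by
    refine (Finset.sum_eq_zero_iff_of_nonneg fun v hv =>
      mul_nonneg (ha v hv) (sub_nonneg.2 (hg v hv))).1 (le_antisymm ?_ ?_)
    · have : ∑ v ∈ s, a v * (g v - m) = g (∑ v ∈ s, a v • v) - m := by
        simp [mul_sub, Finset.sum_sub_distrib, ← Finset.sum_mul, ha1]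
      linarith
    · exact Finset.sum_nonneg fun v hv => mul_nonneg (ha v hv) (sub_nonneg.2 (hg v hv))
  have hne : ∀ v ∈ s, a v ≠ 0 → g v = m := fun v hv h => by
    have := (mul_eq_zero.1 (hzero v hv)).resolve_left h
    linarith
  have hcoe : {v ∈ (s : Set E) | g v = m} = ((s.filter fun v => g v = m : Finset E) : Set E) := by
    ext v; simp
  rw [hcoe, Finset.mem_convexHull']
  refine ⟨a, fun v hv => ha v (Finset.mem_of_mem_filter v hv), ?_, ?_⟩
  · rw [← ha1]
    exact Finset.sum_filter_of_ne hne
  · exact Finset.sum_filter_of_ne fun v hv h => hne v hv fun h0 => h (by simp [h0])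

theorem le_of_mem_convexHull {s : Set E} (g : Module.Dual ℝ E) {m : ℝ}
    (hg : ∀ v ∈ s, m ≤ g v) {x : E} (hx : x ∈ convexHull ℝ s) : m ≤ g x :=
  convexHull_min hg (convex_halfSpace_ge g.isLinear m) hx

theorem IsPolytope.convex {P : Set E} (hP : IsPolytope P) : Convex ℝ P := by
  obtain ⟨s, -, -, rfl⟩ := hP
  exact convex_convexHull ℝ s


variable [TopologicalSpace E] [IsTopologicalAddGroup E] [ContinuousSMul ℝ E] {P : Set E}

theorem IsPolytope.isCompact (hP : IsPolytope P) : IsCompact P := by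
  obtain ⟨s, hs, -, rfl⟩ := hP
  exact hs.isCompact_convexHull ℝ

variable [T2Space E] [LocallyConvexSpace ℝ E]

theorem IsPolytope.convexHull_vert (hP : IsPolytope P) : convexHull ℝ (Vert P) = P := by
  have h : closure (convexHull ℝ (Vert P)) = P :=
    closure_convexHull_extremePoints hP.isCompact hP.convex
  rwa [(hP.finite_vert.isCompact_convexHull ℝ).isClosed.closure_eq] at h

/-- Every vertex of a polytope is exposed. -/
theorem IsPolytope.exists_dual_lt (hP : IsPolytope P) {p : E} (hp : p ∈ Vert P) :
    ∃ f : Module.Dual ℝ E, ∀ y ∈ P, y ≠ p → f p < f y := by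
  have hfin : (Vert P \ {p}).Finite := hP.finite_vert.subset sdiff_subset
  have hsub : convexHull ℝ (Vert P \ {p}) ⊆ P :=
    convexHull_min (sdiff_subset.trans extremePoints_subset) hP.convex
  have hnot : p ∉ convexHull ℝ (Vert P \ {p}) := fun h => by
    have h1 : p ∈ (convexHull ℝ (Vert P \ {p})).extremePoints ℝ :=
      inter_extremePoints_subset_extremePoints_of_subset hsub ⟨h, hp⟩
    exact (extremePoints_convexHull_subset h1).2 rfl
  obtain ⟨f, u, hu, hf⟩ := geometric_hahn_banach_point_closed (convex_convexHull ℝ _)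
    (hfin.isCompact_convexHull ℝ).isClosed hnot
  refine ⟨f.toLinearMap, fun y hy hyp => ?_⟩
  -- Such a `y` would be a convex combination of vertices minimizing `f`, and `p` is the only one.
  by_contra hle
  have hle' : f y ≤ f p := not_lt.1 hle
  have hy' : y ∈ convexHull ℝ (Vert P) := by rwa [hP.convexHull_vert]
  have hmin := mem_convexHull_of_minimal hP.finite_vert f.toLinearMap (m := f p) (fun v hv => by
    by_cases hvp : v = p
    · simp [hvp]
    · exact (hu.trans (hf v (subset_convexHull ℝ _ ⟨hv, hvp⟩))).le) hy' hle'
  have hsing : {v ∈ Vert P | f.toLinearMap v = f p} ⊆ {p} := fun v hv => by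
    by_contra hvp
    exact (hu.trans (hf v (subset_convexHull ℝ _ ⟨hv.1, hvp⟩))).ne' hv.2
  have := convexHull_mono hsing hmin
  rw [convexHull_singleton] at this
  exact hyp this

/-- A point of the ambient space outside a polytope is strictly separated from it. -/
theorem IsPolytope.exists_dual_lt_of_notMem (hP : IsPolytope P) {x : E} (hx : x ∉ P) :
    ∃ f : Module.Dual ℝ E, ∀ y ∈ P, f y < f x := by
  obtain ⟨f, u, hf, hu⟩ :=
    geometric_hahn_banach_closed_point hP.convex hP.isCompact.isClosed hx
  exact ⟨f.toLinearMap, fun y hy => (hf y hy).trans hu⟩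

/-- A functional on a polytope attains its minimum at a vertex. -/
theorem IsPolytope.exists_vert_forall_le (hP : IsPolytope P) (f : Module.Dual ℝ E) :
    ∃ p ∈ Vert P, ∀ y ∈ P, f p ≤ f y := by
  have hne : P.Nonempty := by
    obtain ⟨s, -, hs, rfl⟩ := hP
    exact hs.convexHull
  obtain ⟨p, hp, hmin⟩ := Set.exists_min_image (Vert P) f hP.finite_vert
    (hP.isCompact.extremePoints_nonempty hne)
  refine ⟨p, hp, fun y hy => ?_⟩
  rw [← hP.convexHull_vert] at hy
  exact le_of_mem_convexHull f hmin hy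

variable [FiniteDimensional ℝ E]

/-- The tangent cone of a polytope at a vertex is generated by the edge vectors. -/
theorem IsPolytope.sub_mem_span_edgeVectors (hP : IsPolytope P) {p : E} (hp : p ∈ Vert P) {y : E}
    (hy : y ∈ P) : y - p ∈ Submodule.span NNReal (edgeVectors P p) := by
  set K := Submodule.span NNReal (edgeVectors P p) with hK
  have hsmul : ∀ {r : ℝ} {v : E}, 0 ≤ r → v ∈ K → r • v ∈ K := fun {r v} hr hv =>
    K.smul_mem (⟨r, hr⟩ : NNReal) hv
  have hKconv : Convex ℝ (K : Set E) := fun u hu v hv a b ha hb _ =>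
    K.add_mem (hsmul ha hu) (hsmul hb hv)
  obtain ⟨f, hf⟩ := hP.exists_dual_lt hp
  have hfpos : ∀ v ∈ Vert P \ {p}, 0 < f (v - p) := fun v hv => by
    simpa using hf v hv.1.1 hv.2
  -- Vertex figure: directions from `p` to the other vertices, scaled to lie in `f = 1`. Its extreme
  -- points will be the edge directions.
  let z : E → E := fun v => (f (v - p))⁻¹ • (v - p)
  have hz : ∀ v ∈ Vert P \ {p}, f (v - p) • z v = v - p := fun v hv =>
    smul_inv_smul₀ (hfpos v hv).ne' _
  have hfz : ∀ v ∈ Vert P \ {p}, f (z v) = 1 := fun v hv => by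
    simp only [z, map_smul, smul_eq_mul]
    exact inv_mul_cancel₀ (hfpos v hv).ne'
  suffices hvert : ∀ v ∈ Vert P \ {p}, z v ∈ K by
    have hvK : ∀ v ∈ Vert P, v - p ∈ K := fun v hv => by
      by_cases hvp : v = p
      · simp [hvp]
      · rw [← hz v ⟨hv, hvp⟩]
        exact hsmul (hfpos v ⟨hv, hvp⟩).le (hvert v ⟨hv, hvp⟩)
    rw [← hP.convexHull_vert] at hy
    have hc : Convex ℝ ((fun v => v + -p) ⁻¹' (K : Set E)) := hKconv.translate_preimage_left _
    simpa [sub_eq_add_neg] using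
      convexHull_min (fun v hv => by simpa [sub_eq_add_neg] using hvK v hv) hc hy
  intro v₀ hv₀
  have hfin : (z '' (Vert P \ {p})).Finite := (hP.finite_vert.subset sdiff_subset).image z
  have hQ : IsPolytope (convexHull ℝ (z '' (Vert P \ {p}))) :=
    ⟨_, hfin, ⟨z v₀, mem_image_of_mem z hv₀⟩, rfl⟩
  set Q := convexHull ℝ (z '' (Vert P \ {p})) with hQdef
  have hzQ : ∀ v ∈ Vert P \ {p}, z v ∈ Q := fun v hv =>
    subset_convexHull ℝ _ (mem_image_of_mem z hv)
  suffices hext : Vert Q ⊆ K by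
    have := hzQ v₀ hv₀
    rw [← hQ.convexHull_vert] at this
    exact convexHull_min hext hKconv this
  intro e he
  obtain ⟨g, hg⟩ := hQ.exists_dual_lt he
  obtain ⟨v₁, hv₁, hv₁e⟩ := extremePoints_convexHull_subset he
  -- `G` vanishes in direction `e` and is positive in every other vertex direction, so it exposes
  -- the face of `P` on the ray from `p` along `e`.
  let G : Module.Dual ℝ E := g - g e • f
  have hGz : ∀ v ∈ Vert P \ {p}, G (z v) = g (z v) - g e := fun v hv => by
    simp [G, hfz v hv]
  have hGpos : ∀ v ∈ Vert P \ {p}, z v ≠ e → 0 < G (v - p) := fun v hv hne => by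
    rw [← hz v hv, map_smul, hGz v hv]
    exact mul_pos (hfpos v hv) (sub_pos.2 (hg _ (hzQ v hv) hne))
  have hGzero : ∀ v ∈ Vert P \ {p}, z v = e → G v = G p := fun v hv h => by
    have : G (v - p) = 0 := by rw [← hz v hv, map_smul, hGz v hv, h]; simp
    rwa [map_sub, sub_eq_zero] at this
  have hGnonneg : ∀ v ∈ Vert P, G p ≤ G v := fun v hv => by
    by_cases hvp : v = p
    · rw [hvp]
    by_cases h : z v = e
    · exact (hGzero v ⟨hv, hvp⟩ h).ge
    · have := hGpos v ⟨hv, hvp⟩ h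
      rw [map_sub] at this
      linarith
  have hGP : ∀ y ∈ P, G p ≤ G y := fun y hy => by
    rw [← hP.convexHull_vert] at hy
    exact le_of_mem_convexHull G hGnonneg hy
  -- The farthest vertex on that ray is the other end of the edge.
  obtain ⟨q, ⟨hq, hqe⟩, hqmax⟩ := ((hP.finite_vert.subset sdiff_subset).subset
    (sep_subset (Vert P \ {p}) fun v => z v = e)).exists_maximalFor (fun v => f (v - p)) _
      ⟨v₁, hv₁, hv₁e⟩
  have hqmax' : ∀ v ∈ Vert P \ {p}, z v = e → f (v - p) ≤ f (q - p) := fun v hv h =>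
    (le_total (f (v - p)) (f (q - p))).elim id fun h' => hqmax ⟨hv, h⟩ h'
  have hseg : segment ℝ p q = {x ∈ P | ∀ y ∈ P, (-G) y ≤ (-G) x} := by
    apply Subset.antisymm
    · intro x hx
      refine ⟨hP.convex.segment_subset hp.1 hq.1.1 hx, fun y hy => ?_⟩
      have hGx : G x = G p := by
        obtain ⟨a, b, -, -, hab, rfl⟩ := hx
        rw [map_add, map_smul, map_smul, hGzero q hq hqe, ← add_smul, hab, one_smul]
      rw [LinearMap.neg_apply, LinearMap.neg_apply, hGx]
      exact neg_le_neg (hGP y hy)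
    · rintro x ⟨hx, hmax⟩
      have hGx : G x ≤ G p := by
        have := hmax p hp.1
        rw [LinearMap.neg_apply, LinearMap.neg_apply] at this
        linarith
      rw [← hP.convexHull_vert] at hx
      refine convexHull_min ?_ (convex_segment p q)
        (mem_convexHull_of_minimal hP.finite_vert G hGnonneg hx hGx)
      rintro v ⟨hv, hvG⟩
      by_cases hvp : v = p
      · rw [hvp]; exact left_mem_segment ℝ p q
      have hv' : v ∈ Vert P \ {p} := ⟨hv, hvp⟩
      have hze : z v = e := by
        by_contra h
        have := hGpos v hv' h
        rw [map_sub] at this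
        linarith
      rw [segment_eq_image']
      refine ⟨f (v - p) / f (q - p), ⟨div_nonneg (hfpos v hv').le (hfpos q hq).le,
        div_le_one_of_le₀ (hqmax' v hv' hze) (hfpos q hq).le⟩, ?_⟩
      have h2 : f (q - p) • e = q - p := by rw [← hqe, hz q hq]
      have h3 : f (v - p) • e = v - p := by rw [← hze, hz v hv']
      simp only
      have h4 : (f (v - p) / f (q - p)) • (q - p) = v - p := by
        nth_rewrite 2 [← h2]
        rw [smul_smul, div_mul_cancel₀ _ (hfpos q hq).ne', h3]
      rw [h4, add_sub_cancel]
  have hedge : q - p ∈ edgeVectors P p :=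
    ⟨q, hq.1, hq.2, fun _ => ⟨LinearMap.toContinuousLinearMap (-G), hseg⟩, rfl⟩
  have : e = (f (q - p))⁻¹ • (q - p) := hqe.symm
  rw [this]
  exact hsmul (inv_nonneg.2 (hfpos q hq).le) (Submodule.subset_span hedge)

end Polytope

/-! ### Facet functionals of a simple polytope. -/

section FacetSystem

variable {E : Type*} [AddCommGroup E] [Module ℝ E] [TopologicalSpace E]

/-- The facet functionals of a simple polytope on the hyperplane `⟨η, R⟩ = 1`, normalised to take
the value `1` at a fixed vector `center`: the functional `normal p w` cuts out the facet that
contains the vertex `p` and all edges at `p` except the one in direction `w`. -/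
structure FacetSystem (R : Module.Dual ℝ E) (P : Set E) where
  vert : Finset E
  mem_vert : ∀ {p}, p ∈ vert ↔ p ∈ Vert P
  edge : E → Finset E
  mem_edge : ∀ {p w}, w ∈ edge p ↔ w ∈ edgeVectors P p
  normal : E → E → Module.Dual ℝ E
  center : E
  apply_center_pos : 0 < R center
  eq_one : ∀ {y}, y ∈ P → R y = 1
  normal_apply_center : ∀ {p w}, p ∈ vert → w ∈ edge p → normal p w center = 1
  normal_apply_vert : ∀ {p w}, p ∈ vert → w ∈ edge p → normal p w p = 0
  normal_apply_self : ∀ {p w}, p ∈ vert → w ∈ edge p → 0 < normal p w w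
  normal_apply_ne : ∀ {p w w'}, p ∈ vert → w ∈ edge p → w' ∈ edge p → w' ≠ w →
    normal p w w' = 0
  expand : ∀ {p}, p ∈ vert → ∀ x,
    x = R x • p + ∑ w ∈ edge p, (normal p w x / normal p w w) • w
  normal_nonneg : ∀ {p w y}, p ∈ vert → w ∈ edge p → y ∈ P → 0 ≤ normal p w y
  exists_normal_eq : ∀ {p w q}, p ∈ vert → w ∈ edge p → q ∈ vert → normal p w q = 0 →
    ∃ w' ∈ edge q, normal p w = normal q w'
  mem_of_nonneg : ∀ {y}, R y = 1 → (∀ p ∈ vert, ∀ w ∈ edge p, 0 ≤ normal p w y) → y ∈ P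
  exists_vert_forall_le : ∀ f : Module.Dual ℝ E, ∃ p ∈ vert, ∀ y ∈ P, f p ≤ f y
  exists_dual_lt : ∀ {x}, x ∉ P → ∃ f : Module.Dual ℝ E, ∀ y ∈ P, f y < f x

theorem add_mem_vert_of_mem_edgeVectors {P : Set E} {p w : E} (hw : w ∈ edgeVectors P p) :
    p + w ∈ Vert P := by
  obtain ⟨q, hq, -, -, rfl⟩ := hw
  rwa [add_sub_cancel]

variable {R : Module.Dual ℝ E} {n : ℕ} {P : Set E}

namespace IsSimplePolytopeOn

theorem eq_one (hP : IsSimplePolytopeOn R n P) {y : E} (hy : y ∈ P) : R y = 1 := by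
  have := subset_affineSpan ℝ P hy
  rwa [hP.affineSpan_eq] at this

theorem apply_edgeVector (hP : IsSimplePolytopeOn R n P) {p w : E} (hp : p ∈ Vert P)
    (hw : w ∈ edgeVectors P p) : R w = 0 := by
  have h := hP.eq_one (add_mem_vert_of_mem_edgeVectors hw).1
  rw [map_add, hP.eq_one hp.1] at h
  linarith

variable [FiniteDimensional ℝ E] [IsTopologicalAddGroup E] [ContinuousSMul ℝ E] [T2Space E]
  [LocallyConvexSpace ℝ E]

/-- The directions of the affine span of `P` are spanned by the differences `y - p`, which lie in
the cone of edges. -/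
theorem ker_le_span (hP : IsSimplePolytopeOn R n P) {p : E} (hp : p ∈ Vert P) :
    LinearMap.ker R ≤ Submodule.span ℝ (edgeVectors P p) := by
  intro x hx
  have h1 : p + x ∈ affineSpan ℝ P := by
    have : p + x ∈ {η | R η = 1} := by
      simp [hP.eq_one hp.1, LinearMap.mem_ker.1 hx]
    rwa [← hP.affineSpan_eq] at this
  have h2 := AffineSubspace.vsub_mem_direction h1 (subset_affineSpan ℝ P hp.1)
  rw [direction_affineSpan, vectorSpan_eq_span_vsub_set_right ℝ hp.1] at h2
  simp only [vsub_eq_sub, add_sub_cancel_left] at h2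
  refine Submodule.span_le.2 ?_ h2
  rintro _ ⟨y, hy, rfl⟩
  exact Submodule.span_subset_span NNReal ℝ _
    (hP.isPolytope.sub_mem_span_edgeVectors hp hy)

/-- The functionals dual to the edge vectors at a vertex of a simple polytope. -/
theorem exists_dual_edges (hn : Module.finrank ℝ E = n + 1) (hP : IsSimplePolytopeOn R n P)
    {p : E} (hp : p ∈ Vert P) {T : Finset E} (hT : ∀ w, w ∈ T ↔ w ∈ edgeVectors P p) :
    ∃ d : E → Module.Dual ℝ E, (∀ w ∈ T, d w p = 0) ∧ (∀ w ∈ T, d w w = 1) ∧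
      (∀ w ∈ T, ∀ w' ∈ T, w' ≠ w → d w w' = 0) ∧
      (∀ x, x = R x • p + ∑ w ∈ T, d w x • w) ∧
      ∀ w ∈ T, ∀ y ∈ P, 0 ≤ d w y := by
  classical
  have hTcoe : (T : Set E) = edgeVectors P p := by ext; simp [hT]
  -- Simplicity enters here: `p` and its `n` edge vectors span a space of dimension `n + 1`, so they
  -- form a basis, and `d` consists of its coordinate functionals.
  let v : Option T → E := fun i => i.elim p (fun w => w)
  have hcard : Fintype.card (Option T) = Module.finrank ℝ E := by
    rw [Fintype.card_option, Fintype.card_coe, hn, ← hP.ncard_edgeVectors p hp, ← hTcoe,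
      Set.ncard_coe_finset]
  have hspan : ⊤ ≤ Submodule.span ℝ (Set.range v) := by
    intro x _
    have h1 : x - R x • p ∈ Submodule.span ℝ (Set.range v) := by
      have : x - R x • p ∈ LinearMap.ker R := by simp [hP.eq_one hp.1]
      refine Submodule.span_mono ?_ (hP.ker_le_span hp this)
      intro w hw
      exact ⟨some ⟨w, (hT w).2 hw⟩, rfl⟩
    have h2 : R x • p ∈ Submodule.span ℝ (Set.range v) :=
      Submodule.smul_mem _ _ (Submodule.subset_span ⟨none, rfl⟩)
    simpa using Submodule.add_mem _ h1 h2
  let b := basisOfTopLeSpanOfCardEqFinrank v hspan hcard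
  have hb : ∀ i, b i = v i := fun i => by simp [b]
  have hbn : b none = p := hb none
  have hbs : ∀ w : T, b (some w) = w := fun w => hb (some w)
  let d : E → Module.Dual ℝ E := fun w =>
    if h : w ∈ T then b.coord (some ⟨w, h⟩) else 0
  have hd : ∀ (w : E) (h : w ∈ T), d w = b.coord (some ⟨w, h⟩) := fun w h => dif_pos h
  have hdp : ∀ w ∈ T, d w p = 0 := fun w hw => by
    rw [hd w hw, ← hbn]; simp
  have hdw : ∀ w ∈ T, d w w = 1 := fun w hw => by
    have h : b.coord (some ⟨w, hw⟩) (b (some ⟨w, hw⟩)) = 1 := by simp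
    rwa [hbs, ← hd w hw] at h
  have hdne : ∀ w ∈ T, ∀ w' ∈ T, w' ≠ w → d w w' = 0 := fun w hw w' hw' hne => by
    rw [hd w hw, show w' = b (some ⟨w', hw'⟩) from (hbs ⟨w', hw'⟩).symm]
    simp [hne]
  have hexp : ∀ x, x = R x • p + ∑ w ∈ T, d w x • w := fun x => by
    have h1 : x = b.repr x none • p + ∑ w ∈ T, d w x • w := by
      conv_lhs => rw [← b.sum_repr x, Fintype.sum_option, hbn]
      rw [← Finset.sum_coe_sort T]
      congr 1
      refine Finset.sum_congr rfl fun w _ => ?_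
      rw [hbs, hd w w.2]
      rfl
    have h2 : R x = b.repr x none := by
      conv_lhs => rw [h1]
      rw [map_add, map_smul, hP.eq_one hp.1, map_sum, Finset.sum_eq_zero, smul_eq_mul, mul_one,
        add_zero]
      intro w hw
      rw [map_smul, hP.apply_edgeVector hp ((hT w).1 hw), smul_zero]
    rw [h2]
    exact h1
  refine ⟨d, hdp, hdw, hdne, hexp, fun w hw y hy => ?_⟩
  have h1 : 0 ≤ d w (y - p) := by
    refine Submodule.span_induction (p := fun u _ => 0 ≤ d w u) ?_ (by simp) ?_ ?_
      (hP.isPolytope.sub_mem_span_edgeVectors hp hy)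
    · intro w' hw'
      by_cases h : w' = w
      · rw [h, hdw w hw]; exact zero_le_one
      · rw [hdne w hw w' ((hT w').2 hw') h]
    · intro a c _ _ ha hc
      rw [map_add]; exact add_nonneg ha hc
    · intro r a _ ha
      have : d w (r • a) = (r : ℝ) * d w a := (d w).map_smul (r : ℝ) a
      rw [this]; exact mul_nonneg r.2 ha
  rwa [map_sub, hdp w hw, sub_zero] at h1

/-- The dual functionals at the vertices, rescaled, form the system; the substance is that those of
one facet seen from two vertices agree, and that their inequalities define `P`. -/
theorem nonempty_facetSystem (hn : Module.finrank ℝ E = n + 1)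
    (hP : IsSimplePolytopeOn R n P) : Nonempty (FacetSystem R P) := by
  classical
  let V : Finset E := hP.isPolytope.finite_vert.toFinset
  have hV : ∀ {p}, p ∈ V ↔ p ∈ Vert P := by simp [V]
  let T : E → Finset E := fun p => (hP.isPolytope.finite_edgeVectors p).toFinset
  have hT : ∀ {p w}, w ∈ T p ↔ w ∈ edgeVectors P p := by simp [T]
  have hex := fun (p : E) (hp : p ∈ V) =>
    hP.exists_dual_edges hn (hV.1 hp) (T := T p) fun w => hT
  choose! d hdp hdw hdne hexp hnn using hex
  have hVP : ∀ {p}, p ∈ V → p ∈ P := fun hp => (hV.1 hp).1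
  have hadd : ∀ {p w}, w ∈ T p → p + w ∈ V := fun hw =>
    hV.2 (add_mem_vert_of_mem_edgeVectors (hT.1 hw))
  have hVne : V.Nonempty := by
    obtain ⟨p, hp, -⟩ := hP.isPolytope.exists_vert_forall_le 0
    exact ⟨p, hV.2 hp⟩
  -- Every `d p w` is positive at the sum of the vertices, because it is positive at `p + w`.
  -- Normalising there makes proportional functionals equal.
  let c : E := ∑ v ∈ V, v
  have hRc : R c = V.card := by
    simp only [c, map_sum]
    rw [Finset.sum_congr rfl fun v hv => hP.eq_one (hVP hv)]
    simp
  have hRc0 : 0 < R c := by rw [hRc]; exact_mod_cast hVne.card_pos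
  have hdc : ∀ {p w}, p ∈ V → w ∈ T p → 0 < d p w c := fun {p w} hp hw => by
    simp only [c, map_sum]
    refine Finset.sum_pos' (fun v hv => hnn p hp w hw v (hVP hv)) ⟨p + w, hadd hw, ?_⟩
    rw [map_add, hdp p hp w hw, hdw p hp w hw, zero_add]
    exact zero_lt_one
  have happly : ∀ (h : Module.Dual ℝ E) {q}, q ∈ V → ∀ x,
      h x = R x * h q + ∑ w ∈ T q, d q w x * h w := fun h q hq x => by
    conv_lhs => rw [hexp q hq x]
    simp
  refine ⟨{
    vert := V
    mem_vert := hV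
    edge := T
    mem_edge := hT
    normal := fun p w => (d p w c)⁻¹ • d p w
    center := c
    apply_center_pos := hRc0
    eq_one := hP.eq_one
    normal_apply_center := fun {p w} hp hw => inv_mul_cancel₀ (hdc hp hw).ne'
    normal_apply_vert := fun {p w} hp hw => by simp [hdp p hp w hw]
    normal_apply_self := fun {p w} hp hw => by simp [hdw p hp w hw, hdc hp hw]
    normal_apply_ne := fun {p w w'} hp hw hw' hne => by simp [hdne p hp w hw w' hw' hne]
    expand := ?_
    normal_nonneg := fun {p w y} hp hw hy =>
      mul_nonneg (inv_pos.2 (hdc hp hw)).le (hnn p hp w hw y hy)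
    exists_normal_eq := ?_
    mem_of_nonneg := ?_
    exists_vert_forall_le := fun f => by simpa [hV] using hP.isPolytope.exists_vert_forall_le f
    exists_dual_lt := hP.isPolytope.exists_dual_lt_of_notMem }⟩
  · intro p hp x
    conv_lhs => rw [hexp p hp x]
    congr 1
    refine Finset.sum_congr rfl fun w hw => ?_
    have := (hdc hp hw).ne'
    simp [hdw p hp w hw]
    field_simp
  · intro p w q hp hw hq hpq
    have hq0 : d p w q = 0 := by
      simpa [(hdc hp hw).ne'] using hpq
    have hnonneg : ∀ w' ∈ T q, 0 ≤ d p w w' := fun w' hw' => by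
      have := hnn p hp w hw _ (hVP (hadd hw'))
      rwa [map_add, hq0, zero_add] at this
    -- Otherwise `d p w`, zero at `q` and along all edges at `q`, would vanish at `c`.
    obtain ⟨w', hw', hpos⟩ : ∃ w' ∈ T q, 0 < d p w w' := by
      by_contra! hcon
      have h1 := happly (d p w) hq c
      rw [hq0, Finset.sum_eq_zero fun w' hw' => by
        rw [le_antisymm (hcon w' hw') (hnonneg w' hw'), mul_zero]] at h1
      have := hdc hp hw
      simp only [mul_zero, add_zero] at h1
      exact this.ne' h1
    -- On `P`, `d p w` is a nonnegative combination of the functionals at `q`, with positive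
    -- coefficient at `w'`.
    have hvanish : ∀ y ∈ P, d p w y = 0 → d q w' y = 0 := fun y hy h0 => by
      have h1 := happly (d p w) hq y
      rw [h0, hq0, mul_zero, zero_add] at h1
      have h2 := (Finset.sum_eq_zero_iff_of_nonneg fun u hu =>
        mul_nonneg (hnn q hq u hu y hy) (hnonneg u hu)).1 h1.symm w' hw'
      exact (mul_eq_zero.1 h2).resolve_right hpos.ne'
    have hp0 : d q w' p = 0 := hvanish p (hVP hp) (hdp p hp w hw)
    -- `d q w'` vanishes at `p` and along every edge at `p` except `w`, so only the `d p w` term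
    -- survives.
    have hprop : d q w' = d q w' w • d p w := by
      ext x
      rw [happly (d q w') hp x, hp0, mul_zero, zero_add, Finset.sum_eq_single w]
      · simp [mul_comm]
      · intro u hu hne
        have h3 : d q w' (p + u) = 0 := hvanish _ (hVP (hadd hu)) (by
          rw [map_add, hdp p hp w hw, hdne p hp w hw u hu hne, add_zero])
        rw [map_add, hp0, zero_add] at h3
        rw [h3, mul_zero]
      · intro h; exact absurd hw h
    have ht : d q w' w ≠ 0 := fun h => by
      rw [h, zero_smul] at hprop
      have := hdc hq hw'
      rw [hprop] at this
      simp at this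
    refine ⟨w', hw', ?_⟩
    rw [hprop, LinearMap.smul_apply, smul_eq_mul, smul_smul, mul_inv, mul_comm (d q w' w)⁻¹,
      mul_assoc, inv_mul_cancel₀ ht, mul_one]
  · intro y hy hpos
    by_contra hyP
    obtain ⟨f, hf⟩ := hP.isPolytope.exists_dual_lt_of_notMem hyP
    -- At a vertex maximizing `f`, no edge increases `f`, while `y - p` is a nonnegative combination
    -- of the edges; so `f y ≤ f p`, against the separation.
    obtain ⟨p, hp, hmin⟩ := hP.isPolytope.exists_vert_forall_le (-f)
    have hp' := hV.2 hp
    have h1 := happly f hp' y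
    have h2 : ∑ w ∈ T p, d p w y * f w ≤ 0 := Finset.sum_nonpos fun w hw => by
      have h3 := hmin _ (hVP (hadd hw))
      simp only [LinearMap.neg_apply, map_add] at h3
      have h4 := hpos p hp' w hw
      rw [LinearMap.smul_apply, smul_eq_mul] at h4
      exact mul_nonpos_of_nonneg_of_nonpos
        (nonneg_of_mul_nonneg_right h4 (inv_pos.2 (hdc hp' hw))) (by linarith)
    have := hf p hp.1
    rw [hy, one_mul] at h1
    linarith

end IsSimplePolytopeOn

end FacetSystem

/-- The alternating sum over an interval of finite sets. -/
theorem sum_Icc_neg_one_pow_card {α : Type*} [DecidableEq α] (s t : Finset α) :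
    ∑ u ∈ Finset.Icc s t, (-1 : ℤ) ^ u.card = if s = t then (-1) ^ s.card else 0 := by
  by_cases hst : s ⊆ t
  · have hdisj : ∀ u ∈ (t \ s).powerset, Disjoint s u := fun u hu =>
      Finset.disjoint_of_subset_right (Finset.mem_powerset.1 hu) Finset.disjoint_sdiff
    rw [Finset.Icc_eq_image_powerset hst, Finset.sum_image]
    · rw [Finset.sum_congr rfl fun u hu => by
        rw [Finset.card_union_of_disjoint (hdisj u hu), pow_add], ← Finset.mul_sum,
        Finset.sum_powerset_neg_one_pow_card]
      have : t \ s = ∅ ↔ s = t := by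
        rw [Finset.sdiff_eq_empty_iff_subset]
        exact ⟨fun h => hst.antisymm h, fun h => h.ge⟩
      simp [this]
    · intro u hu v hv huv
      simp only at huv
      rw [← Finset.union_sdiff_cancel_left (hdisj u hu), huv,
        Finset.union_sdiff_cancel_left (hdisj v hv)]
  · rw [Finset.Icc_eq_empty hst, Finset.sum_empty, if_neg fun h => hst h.le]

/-! ### The signed count and its independence of the functional. -/

namespace FacetSystem

section Count

open scoped Classical

variable {E : Type*} [AddCommGroup E] [Module ℝ E] [TopologicalSpace E] {R : Module.Dual ℝ E}
  {P : Set E} (S : FacetSystem R P)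

/-- The functionals of the facets through `p`. -/
noncomputable def facetsAt (p : E) : Finset (Module.Dual ℝ E) :=
  (S.edge p).image (S.normal p)

/-- All facet functionals. -/
noncomputable def facets : Finset (Module.Dual ℝ E) :=
  S.vert.biUnion S.facetsAt

/-- The functionals of the facets through `p` opposite to an edge along which `f` increases. -/
noncomputable def upFacets (f : Module.Dual ℝ E) (p : E) : Finset (Module.Dual ℝ E) :=
  ((S.edge p).filter fun w => 0 < f w).image (S.normal p)

/-- The points of `P` on all the facets in `J`. -/
def face (_ : FacetSystem R P) (J : Finset (Module.Dual ℝ E)) : Set E :=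
  {y ∈ P | ∀ h ∈ J, h y = 0}

/-- The signed number of vertices whose facets in `A` are exactly those opposite to an edge along
which `f` increases. -/
noncomputable def signedCount (f : Module.Dual ℝ E) (A : Finset (Module.Dual ℝ E)) : ℤ :=
  ∑ p ∈ S.vert, if S.upFacets f p = A ∩ S.facetsAt p then (-1) ^ (S.upFacets f p).card else 0

/-- The facet functionals that are negative at `x`. -/
noncomputable def negFacets (x : E) : Finset (Module.Dual ℝ E) :=
  S.facets.filter fun h => h x < 0

/-- `f` does not vanish on any edge. -/
def IsGeneric (f : Module.Dual ℝ E) : Prop :=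
  ∀ p ∈ S.vert, ∀ w ∈ S.edge p, f w ≠ 0

variable {S} {f : Module.Dual ℝ E} {p x : E} {J A : Finset (Module.Dual ℝ E)}

theorem vert_subset (hp : p ∈ S.vert) : p ∈ P := (S.mem_vert.1 hp).1

theorem add_mem_vert {w : E} (hw : w ∈ S.edge p) : p + w ∈ S.vert :=
  S.mem_vert.2 (add_mem_vert_of_mem_edgeVectors (S.mem_edge.1 hw))

theorem normal_injOn (hp : p ∈ S.vert) : Set.InjOn (S.normal p) (S.edge p) := by
  intro w hw w' hw' h
  by_contra hne
  have h1 := S.normal_apply_self hp hw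
  rw [h, S.normal_apply_ne hp hw' hw hne] at h1
  exact h1.false

theorem normal_mem_facets {w : E} (hp : p ∈ S.vert) (hw : w ∈ S.edge p) :
    S.normal p w ∈ S.facets :=
  Finset.mem_biUnion.2 ⟨p, hp, Finset.mem_image_of_mem _ hw⟩

theorem mem_facets {h : Module.Dual ℝ E} :
    h ∈ S.facets ↔ ∃ p ∈ S.vert, ∃ w ∈ S.edge p, S.normal p w = h := by
  simp [facets, facetsAt]

theorem facetsAt_subset (hp : p ∈ S.vert) : S.facetsAt p ⊆ S.facets :=
  Finset.subset_biUnion_of_mem S.facetsAt hp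

theorem upFacets_subset : S.upFacets f p ⊆ S.facetsAt p :=
  Finset.image_subset_image (Finset.filter_subset _ _)

theorem normal_mem_upFacets {w : E} (hp : p ∈ S.vert) (hw : w ∈ S.edge p) :
    S.normal p w ∈ S.upFacets f p ↔ 0 < f w := by
  rw [upFacets, Finset.mem_image]
  constructor
  · rintro ⟨w', hw', h⟩
    rw [Finset.mem_filter] at hw'
    rw [← normal_injOn hp hw'.1 hw h]
    exact hw'.2
  · exact fun h => ⟨w, Finset.mem_filter.2 ⟨hw, h⟩, rfl⟩

/-- Turns the combinatorial incidence of facets and vertices into vanishing, through the matching of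
functionals between vertices. -/
theorem mem_facetsAt {h : Module.Dual ℝ E} (hh : h ∈ S.facets) (hp : p ∈ S.vert) :
    h ∈ S.facetsAt p ↔ h p = 0 := by
  constructor
  · intro h1
    obtain ⟨w, hw, rfl⟩ := Finset.mem_image.1 h1
    exact S.normal_apply_vert hp hw
  · intro h0
    obtain ⟨q, hq, w, hw, rfl⟩ := mem_facets.1 hh
    obtain ⟨w', hw', h'⟩ := S.exists_normal_eq hq hw hp h0
    rw [h']
    exact Finset.mem_image_of_mem _ hw'

theorem nonneg_of_mem_facets {h : Module.Dual ℝ E} (hh : h ∈ S.facets) {y : E} (hy : y ∈ P) :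
    0 ≤ h y := by
  obtain ⟨q, hq, w, hw, rfl⟩ := mem_facets.1 hh
  exact S.normal_nonneg hq hw hy

theorem apply_center {h : Module.Dual ℝ E} (hh : h ∈ S.facets) : h S.center = 1 := by
  obtain ⟨q, hq, w, hw, rfl⟩ := mem_facets.1 hh
  exact S.normal_apply_center hq hw

theorem apply_eq (hp : p ∈ S.vert) (f : Module.Dual ℝ E) (x : E) :
    f x = R x * f p + ∑ w ∈ S.edge p, S.normal p w x / S.normal p w w * f w := by
  conv_lhs => rw [S.expand hp x]
  simp

/-- Every nonempty face has a vertex at which all edges along which `f` increases leave the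
face. -/
theorem exists_top (hJ : J ⊆ S.facets) (hne : (S.face J).Nonempty) (f : Module.Dual ℝ E) :
    ∃ p ∈ S.vert, S.upFacets f p ⊆ J ∧ J ⊆ S.facetsAt p := by
  obtain ⟨y, hy, hyJ⟩ := hne
  have hvert : (S.vert.filter fun p => ∀ h ∈ J, h p = 0).Nonempty := by
    -- The sum over `J` is nonnegative on `P` and zero at `y`, so a minimizing vertex lies on all
    -- facets in `J`.
    obtain ⟨p, hp, hmin⟩ := S.exists_vert_forall_le (∑ h ∈ J, h)
    have h0 : ∑ h ∈ J, h p = 0 := by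
      refine le_antisymm ?_ (Finset.sum_nonneg fun h hh =>
        nonneg_of_mem_facets (hJ hh) (vert_subset hp))
      have := hmin y hy
      simp only [LinearMap.sum_apply] at this
      rwa [Finset.sum_eq_zero hyJ] at this
    exact ⟨p, Finset.mem_filter.2 ⟨hp, (Finset.sum_eq_zero_iff_of_nonneg fun h hh =>
      nonneg_of_mem_facets (hJ hh) (vert_subset hp)).1 h0⟩⟩
  obtain ⟨p, hp, hmax⟩ := Finset.exists_max_image _ f hvert
  rw [Finset.mem_filter] at hp
  have hJp : J ⊆ S.facetsAt p := fun h hh => (mem_facetsAt (hJ hh) hp.1).2 (hp.2 h hh)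
  refine ⟨p, hp.1, ?_, hJp⟩
  intro h hh
  obtain ⟨w, hw, rfl⟩ := Finset.mem_image.1 hh
  rw [Finset.mem_filter] at hw
  by_contra hnot
  -- Moving along `w` leaves only the facet opposite to `w`; if that one is not in `J`, then `p + w`
  -- is a higher vertex of the face.
  have := hmax (p + w) (Finset.mem_filter.2 ⟨add_mem_vert hw.1, fun h hh => by
    obtain ⟨w', hw', rfl⟩ := Finset.mem_image.1 (hJp hh)
    have hne : w ≠ w' := fun h => hnot (h ▸ hh)
    rw [map_add, hp.2 _ hh, S.normal_apply_ne hp.1 hw' hw.1 hne, add_zero]⟩)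
  rw [map_add] at this
  linarith [hw.2]

/-- On the face, edges increasing `f` have coefficient zero and the others contribute nonpositively;
hence `p` maximizes `f` on the face, uniquely when `f` is generic. -/
theorem sum_nonpos_of_upFacets_subset (hp : p ∈ S.vert) (hup : S.upFacets f p ⊆ J) {y : E}
    (hy : y ∈ S.face J) {w : E} (hw : w ∈ S.edge p) :
    S.normal p w y / S.normal p w w * f w ≤ 0 := by
  by_cases h : 0 < f w
  · rw [hy.2 _ (hup ((normal_mem_upFacets hp hw).2 h)), zero_div, zero_mul]
  · exact mul_nonpos_of_nonneg_of_nonpos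
      (div_nonneg (S.normal_nonneg hp hw hy.1) (S.normal_apply_self hp hw).le) (not_lt.1 h)

theorem apply_le_top (hp : p ∈ S.vert) (hup : S.upFacets f p ⊆ J) {y : E} (hy : y ∈ S.face J) :
    f y ≤ f p := by
  have h := apply_eq hp f y
  have h2 := Finset.sum_nonpos fun w hw => sum_nonpos_of_upFacets_subset hp hup hy (w := w) hw
  rw [S.eq_one hy.1, one_mul] at h
  linarith

theorem eq_top (hf : S.IsGeneric f) (hp : p ∈ S.vert) (hup : S.upFacets f p ⊆ J) {y : E}
    (hy : y ∈ S.face J) (hle : f p ≤ f y) : y = p := by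
  have h := apply_eq hp f y
  rw [S.eq_one hy.1, one_mul] at h
  have h0 := (Finset.sum_eq_zero_iff_of_nonpos fun w hw =>
    sum_nonpos_of_upFacets_subset hp hup hy (w := w) hw).1
      (le_antisymm (Finset.sum_nonpos fun w hw =>
        sum_nonpos_of_upFacets_subset hp hup hy (w := w) hw) (by linarith))
  rw [S.expand hp y, S.eq_one hy.1, one_smul, Finset.sum_eq_zero, add_zero]
  intro w hw
  rw [(mul_eq_zero.1 (h0 w hw)).resolve_right (hf p hp w hw), zero_smul]

theorem top_unique (hf : S.IsGeneric f) (hJ : J ⊆ S.facets) {q : E} (hp : p ∈ S.vert)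
    (hup : S.upFacets f p ⊆ J) (hJp : J ⊆ S.facetsAt p) (hq : q ∈ S.vert)
    (hup' : S.upFacets f q ⊆ J) (hJq : J ⊆ S.facetsAt q) : p = q := by
  have h1 : p ∈ S.face J := ⟨vert_subset hp, fun h hh => (mem_facetsAt (hJ hh) hp).1 (hJp hh)⟩
  have h2 : q ∈ S.face J := ⟨vert_subset hq, fun h hh => (mem_facetsAt (hJ hh) hq).1 (hJq hh)⟩
  exact eq_top hf hq hup' h1 (apply_le_top hp hup h2)

/-- The signed count is an alternating sum over the nonempty faces. -/
theorem signedCount_eq_sum_face (hf : S.IsGeneric f) (hA : A ⊆ S.facets) :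
    S.signedCount f A = ∑ J ∈ A.powerset, if (S.face J).Nonempty then (-1) ^ J.card else 0 := by
  have hterm : ∀ J ∈ A.powerset, (if (S.face J).Nonempty then (-1 : ℤ) ^ J.card else 0) =
      ∑ p ∈ S.vert, if S.upFacets f p ⊆ J ∧ J ⊆ S.facetsAt p then (-1) ^ J.card else 0 := by
    intro J hJA
    have hJ := (Finset.mem_powerset.1 hJA).trans hA
    by_cases hne : (S.face J).Nonempty
    · obtain ⟨p, hp, hup, hJp⟩ := exists_top hJ hne f
      rw [if_pos hne, Finset.sum_eq_single_of_mem p hp, if_pos ⟨hup, hJp⟩]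
      intro q hq hqp
      exact if_neg fun h => hqp (top_unique hf hJ hq h.1 h.2 hp hup hJp)
    · rw [if_neg hne, Finset.sum_eq_zero]
      intro p hp
      exact if_neg fun h => hne ⟨p, vert_subset hp, fun g hg =>
        (mem_facetsAt (hJ hg) hp).1 (h.2 hg)⟩
  rw [Finset.sum_congr rfl hterm, Finset.sum_comm]
  refine Finset.sum_congr rfl fun p _ => ?_
  -- For fixed `p`, the sets `J` range over the interval from `upFacets f p` to `A ∩ facetsAt p`,
  -- whose alternating sum vanishes unless the ends coincide.
  rw [← sum_Icc_neg_one_pow_card, ← Finset.sum_filter]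
  refine Finset.sum_congr ?_ fun _ _ => rfl
  ext J
  simp only [Finset.mem_Icc, Finset.mem_filter, Finset.mem_powerset, Finset.subset_inter_iff]
  tauto

theorem signedCount_congr {g : Module.Dual ℝ E} (hf : S.IsGeneric f) (hg : S.IsGeneric g)
    (hA : A ⊆ S.facets) : S.signedCount f A = S.signedCount g A := by
  rw [signedCount_eq_sum_face hf hA, signedCount_eq_sum_face hg hA]

theorem signedCount_empty (hf : S.IsGeneric f) : S.signedCount f ∅ = 1 := by
  obtain ⟨p, hp, -⟩ := S.exists_vert_forall_le 0
  rw [signedCount_eq_sum_face hf (Finset.empty_subset _), Finset.powerset_empty,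
    Finset.sum_singleton, if_pos ⟨p, vert_subset hp, by simp⟩]
  simp

/-- All edges at `p` increase `f` iff none increases `-f`, so this count is `(-1)^n` times the count
of `-f` for the empty set. -/
theorem signedCount_facets {n : ℕ} (hn : ∀ p ∈ S.vert, (S.edge p).card = n)
    (hf : S.IsGeneric f) : S.signedCount f S.facets = (-1) ^ n := by
  have hneg : S.IsGeneric (-f) := fun p hp w hw => neg_ne_zero.2 (hf p hp w hw)
  have key : S.signedCount f S.facets = (-1) ^ n * S.signedCount (-f) ∅ := by
    rw [signedCount, signedCount, Finset.mul_sum]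
    refine Finset.sum_congr rfl fun p hp => ?_
    rw [Finset.inter_eq_right.2 (facetsAt_subset hp), Finset.empty_inter]
    have hiff : S.upFacets f p = S.facetsAt p ↔ S.upFacets (-f) p = ∅ := by
      constructor
      · intro h
        refine Finset.eq_empty_of_forall_notMem fun g hg => ?_
        obtain ⟨w, hw, rfl⟩ := Finset.mem_image.1 (upFacets_subset hg)
        have h1 := (normal_mem_upFacets hp hw).1 hg
        have h2 := (normal_mem_upFacets (f := f) hp hw).1 (h ▸ upFacets_subset hg)
        rw [LinearMap.neg_apply] at h1
        linarith
      · intro h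
        refine upFacets_subset.antisymm fun g hg => ?_
        obtain ⟨w, hw, rfl⟩ := Finset.mem_image.1 hg
        rw [normal_mem_upFacets hp hw]
        refine (lt_or_gt_of_ne (hf p hp w hw)).resolve_left fun hlt => ?_
        have : S.normal p w ∈ S.upFacets (-f) p :=
          (normal_mem_upFacets hp hw).2 (neg_pos.2 hlt)
        rw [h] at this
        exact Finset.notMem_empty _ this
    by_cases h : S.upFacets f p = S.facetsAt p
    · rw [if_pos h, if_pos (hiff.1 h), hiff.1 h, h, facetsAt,
        Finset.card_image_of_injOn (normal_injOn hp), hn p hp]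
      simp
    · rw [if_neg h, if_neg (mt hiff.2 h), mul_zero]
  rw [key, signedCount_empty hneg, mul_one]

theorem negFacets_subset : S.negFacets x ⊆ S.facets := Finset.filter_subset _ _

theorem mem_negFacets {h : Module.Dual ℝ E} (hh : h ∈ S.facets) :
    h ∈ S.negFacets x ↔ h x < 0 := by
  simp [negFacets, hh]

/-- A vertex is counted when the facets through it that are negative at `x` are those opposite to
an edge along which `f` increases. -/
theorem upFacets_eq_iff (hp : p ∈ S.vert) :
    S.upFacets f p = S.negFacets x ∩ S.facetsAt p ↔
      ∀ w ∈ S.edge p, (S.normal p w x < 0 ↔ 0 < f w) := by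
  have hmem : ∀ w ∈ S.edge p, (S.normal p w ∈ S.negFacets x ∩ S.facetsAt p ↔
      S.normal p w x < 0) := fun w hw => by
    rw [Finset.mem_inter, mem_negFacets (normal_mem_facets hp hw)]
    exact and_iff_left (Finset.mem_image_of_mem _ hw)
  constructor
  · intro h w hw
    rw [← hmem w hw, ← h, normal_mem_upFacets hp hw]
  · intro h
    ext g
    by_cases hg : g ∈ S.facetsAt p
    · obtain ⟨w, hw, rfl⟩ := Finset.mem_image.1 hg
      rw [hmem w hw, h w hw, normal_mem_upFacets hp hw]
    · exact iff_of_false (fun h => hg (upFacets_subset h)) fun h => hg (Finset.mem_inter.1 h).2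

/-- At a counted vertex each coefficient of `x` is opposed in sign to the slope of `f` on its edge,
forcing `f x ≤ R x * f p`. -/
theorem signedCount_eq_zero (hx : ∀ p ∈ S.vert, R x * f p < f x) :
    S.signedCount f (S.negFacets x) = 0 := by
  refine Finset.sum_eq_zero fun p hp => if_neg fun h => ?_
  rw [upFacets_eq_iff hp] at h
  have h1 := apply_eq hp f x
  have h2 : ∑ w ∈ S.edge p, S.normal p w x / S.normal p w w * f w ≤ 0 := by
    refine Finset.sum_nonpos fun w hw => ?_
    have hself := S.normal_apply_self hp hw
    by_cases hw0 : 0 < f w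
    · exact mul_nonpos_of_nonpos_of_nonneg (div_nonpos_of_nonpos_of_nonneg
        ((h w hw).2 hw0).le hself.le) hw0.le
    · exact mul_nonpos_of_nonneg_of_nonpos (div_nonneg
        (not_lt.1 fun h' => hw0 ((h w hw).1 h')) hself.le) (not_lt.1 hw0)
  linarith [hx p hp]

/-- A strictly separating functional can be perturbed to a generic one. -/
theorem exists_generic (hf : S.IsGeneric f) {g : Module.Dual ℝ E}
    (hx : ∀ p ∈ S.vert, R x * g p < g x) :
    ∃ g' : Module.Dual ℝ E, S.IsGeneric g' ∧ ∀ p ∈ S.vert, R x * g' p < g' x := by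
  have hlim : ∀ y, Filter.Tendsto (fun ε : ℝ => (g + ε • f) y) (nhdsWithin 0 (Ioi 0))
      (nhds (g y)) := fun y => by
    have hc : Continuous fun ε : ℝ => (g + ε • f) y := by
      simp only [LinearMap.add_apply, LinearMap.smul_apply, smul_eq_mul]
      fun_prop
    have := hc.tendsto 0
    simp only [zero_smul, add_zero] at this
    exact this.mono_left nhdsWithin_le_nhds
  have h1 : ∀ᶠ ε : ℝ in nhdsWithin 0 (Ioi 0), ∀ p ∈ S.vert,
      R x * (g + ε • f) p < (g + ε • f) x :=
    (Filter.eventually_all_finset _).2 fun p hp =>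
      ((hlim p).const_mul (R x)).eventually_lt (hlim x) (hx p hp)
  have h2 : ∀ᶠ ε : ℝ in nhdsWithin 0 (Ioi 0), ∀ p ∈ S.vert, ∀ w ∈ S.edge p,
      (g + ε • f) w ≠ 0 := by
    refine (Filter.eventually_all_finset _).2 fun p hp =>
      (Filter.eventually_all_finset _).2 fun w hw => ?_
    by_cases hgw : g w = 0
    · filter_upwards [self_mem_nhdsWithin] with ε hε
      simpa [hgw] using ⟨(mem_Ioi.1 hε).ne', hf p hp w hw⟩
    · exact (hlim w).eventually_ne hgw
  obtain ⟨ε, hε1, hε2⟩ := (h1.and h2).exists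
  exact ⟨g + ε • f, hε2, hε1⟩

theorem signedCount_eq_zero_of_exists (hf : S.IsGeneric f) {g : Module.Dual ℝ E}
    (hx : ∀ p ∈ S.vert, R x * g p < g x) : S.signedCount f (S.negFacets x) = 0 := by
  obtain ⟨g', hg', hx'⟩ := exists_generic hf hx
  rw [signedCount_congr hf hg' negFacets_subset, signedCount_eq_zero hx']

/-! ### The cone over `P` and evaluation of the count. -/

theorem nonneg_of_mem_coneOver {h : Module.Dual ℝ E} (hh : h ∈ S.facets)
    (hx : x ∈ coneOver P) : 0 ≤ h x := by
  obtain ⟨r, hr, y, hy, rfl⟩ := hx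
  rw [map_smul]
  exact mul_nonneg hr (nonneg_of_mem_facets hh hy)

theorem apply_nonneg_of_mem_coneOver (S : FacetSystem R P) (hx : x ∈ coneOver P) : 0 ≤ R x := by
  obtain ⟨r, hr, y, hy, rfl⟩ := hx
  rwa [map_smul, S.eq_one hy, smul_eq_mul, mul_one]

theorem inv_smul_mem_iff (hx : 0 < R x) : (R x)⁻¹ • x ∈ P ↔ ∀ h ∈ S.facets, 0 ≤ h x := by
  constructor
  · intro h g hg
    have := nonneg_of_mem_facets hg h
    rw [map_smul] at this
    exact nonneg_of_mul_nonneg_right this (inv_pos.2 hx)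
  · intro h
    refine S.mem_of_nonneg ?_ fun p hp w hw => ?_
    · rw [map_smul, smul_eq_mul, inv_mul_cancel₀ hx.ne']
    · rw [map_smul]
      exact mul_nonneg (inv_pos.2 hx).le (h _ (normal_mem_facets hp hw))

theorem mem_coneOver_iff (hx : 0 < R x) : x ∈ coneOver P ↔ ∀ h ∈ S.facets, 0 ≤ h x :=
  ⟨fun h _ hg => nonneg_of_mem_coneOver hg h, fun h =>
    ⟨R x, hx.le, _, (inv_smul_mem_iff hx).2 h, (smul_inv_smul₀ hx.ne' x).symm⟩⟩

theorem exists_lt_of_facet_neg (hx : 0 < R x) {h : Module.Dual ℝ E} (hh : h ∈ S.facets)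
    (hneg : h x < 0) : ∃ g : Module.Dual ℝ E, ∀ p ∈ S.vert, R x * g p < g x := by
  have hnot : (R x)⁻¹ • x ∉ P := fun hmem =>
    absurd ((inv_smul_mem_iff hx).1 hmem h hh) (not_le.2 hneg)
  obtain ⟨g, hg⟩ := S.exists_dual_lt hnot
  refine ⟨g, fun p hp => ?_⟩
  have := hg p (vert_subset hp)
  rw [map_smul, smul_eq_mul] at this
  calc R x * g p < R x * ((R x)⁻¹ * g x) := mul_lt_mul_of_pos_left this hx
    _ = g x := mul_inv_cancel_left₀ hx.ne' _

variable [FiniteDimensional ℝ E] [IsTopologicalAddGroup E] [ContinuousSMul ℝ E] [T2Space E]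

/-- An interior point stays in the cone after a small step against `center`, which lowers `R` and
every facet functional; conversely, finitely many strict inequalities define an open set. The
condition on `R` is needed when `n = 0`, where there are no facets. -/
theorem mem_interior_coneOver_iff :
    x ∈ interior (coneOver P) ↔ 0 < R x ∧ ∀ h ∈ S.facets, 0 < h x := by
  constructor
  · intro hx
    have hc : Filter.Tendsto (fun t : ℝ => x - t • S.center) (nhds 0) (nhds x) := by
      have : Continuous fun t : ℝ => x - t • S.center := by fun_prop
      simpa using this.tendsto 0
    have hev := (hc.eventually (mem_interior_iff_mem_nhds.1 hx)).filter_mono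
      (nhdsWithin_le_nhds (s := Ioi 0))
    obtain ⟨t, ht, ht0⟩ := (hev.and self_mem_nhdsWithin).exists
    have ht0 : 0 < t := ht0
    constructor
    · have := S.apply_nonneg_of_mem_coneOver ht
      rw [map_sub, map_smul, smul_eq_mul] at this
      linarith [mul_pos ht0 S.apply_center_pos]
    · intro h hh
      have := nonneg_of_mem_coneOver hh ht
      rw [map_sub, map_smul, smul_eq_mul, apply_center hh] at this
      linarith
  · rintro ⟨hR, hx⟩
    rw [mem_interior_iff_mem_nhds]
    have hpos : ∀ g : Module.Dual ℝ E, 0 < g x → ∀ᶠ y in nhds x, 0 < g y := fun g hg =>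
      (LinearMap.continuous_of_finiteDimensional g).continuousAt.eventually_const_lt hg
    filter_upwards [hpos R hR, (Filter.eventually_all_finset S.facets).2 fun h hh =>
      hpos h (hx h hh)] with y hy1 hy2
    exact (mem_coneOver_iff hy1).2 fun h hh => (hy2 h hh).le

/-- The signed count over the facets that are negative at `x`. -/
theorem signedCount_negFacets {n : ℕ} (hn : ∀ p ∈ S.vert, (S.edge p).card = n)
    (hf : S.IsGeneric f) (x : E) :
    S.signedCount f (S.negFacets x) =
      (coneOver P).indicator 1 x + (-1) ^ n * (-interior (coneOver P)).indicator 1 x := by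
  have hint : 0 ≤ R x → x ∉ -interior (coneOver P) := fun hx h => by
    have := (mem_interior_coneOver_iff (S := S).1 (Set.mem_neg.1 h)).1
    rw [map_neg] at this
    linarith
  by_cases hxC : x ∈ coneOver P
  · have hempty : S.negFacets x = ∅ := Finset.filter_eq_empty_iff.2 fun h hh =>
      not_lt.2 (nonneg_of_mem_coneOver hh hxC)
    rw [hempty, signedCount_empty hf, indicator_of_mem hxC,
      indicator_of_notMem (hint (S.apply_nonneg_of_mem_coneOver hxC))]
    simp
  rw [indicator_of_notMem hxC, zero_add]
  rcases lt_trichotomy (R x) 0 with hx | hx | hx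
  · have hnx : 0 < R (-x) := by rw [map_neg]; linarith
    by_cases hall : ∀ h ∈ S.facets, 0 < h (-x)
    · have hfull : S.negFacets x = S.facets := Finset.filter_eq_self.2 fun h hh => by
        have := hall h hh
        rw [map_neg] at this
        linarith
      rw [hfull, signedCount_facets hn hf, indicator_of_mem
        (Set.mem_neg.2 (mem_interior_coneOver_iff (S := S).2 ⟨hnx, hall⟩))]
      simp
    · rw [indicator_of_notMem fun h =>
        hall (mem_interior_coneOver_iff (S := S).1 (Set.mem_neg.1 h)).2, mul_zero]
      push Not at hall
      obtain ⟨h₀, hh₀, hle⟩ := hall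
      have hlim : ∀ g : Module.Dual ℝ E, Filter.Tendsto (fun t : ℝ => g (-x - t • S.center))
          (nhdsWithin 0 (Ioi 0)) (nhds (g (-x))) := fun g => by
        have hc : Continuous fun t : ℝ => g (-x - t • S.center) := by
          simp only [map_sub, map_smul, smul_eq_mul]
          fun_prop
        have := hc.tendsto 0
        simp only [zero_smul, sub_zero] at this
        exact this.mono_left nhdsWithin_le_nhds
      have hev1 : ∀ᶠ t : ℝ in nhdsWithin 0 (Ioi 0), 0 < R (-x - t • S.center) :=
        (hlim R).eventually_const_lt hnx
      have hev2 : ∀ᶠ t : ℝ in nhdsWithin 0 (Ioi 0), ∀ h ∈ S.facets, 0 < h (-x) →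
          0 < h (-x - t • S.center) :=
        (Filter.eventually_all_finset _).2 fun h _ => by
          by_cases hpos : 0 < h (-x)
          · filter_upwards [(hlim h).eventually_const_lt hpos] with t ht _ using ht
          · exact Filter.Eventually.of_forall fun _ h' => absurd h' hpos
      -- The facet `h₀` may vanish at `-x`, so `x` is moved slightly along `center`: `h₀` becomes
      -- strictly negative at `-x - t • S.center`, while the signs recorded by `negFacets` are
      -- unchanged.
      obtain ⟨t, ⟨ht1, ht2⟩, ht0⟩ := ((hev1.and hev2).and self_mem_nhdsWithin).exists
      have ht0 : 0 < t := ht0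
      have happ : ∀ h ∈ S.facets, h (-x - t • S.center) = h (-x) - t := fun h hh => by
        rw [map_sub, map_smul, apply_center hh, smul_eq_mul, mul_one]
      obtain ⟨g, hg⟩ := exists_lt_of_facet_neg ht1 hh₀ (by rw [happ _ hh₀]; linarith)
      have hsame : S.negFacets x = S.negFacets (x + t • S.center) := by
        refine Finset.filter_congr fun h hh => ?_
        have h1 := happ h hh
        have h2 := ht2 h hh
        have h3 : x + t • S.center = -(-x - t • S.center) := by abel
        rw [h3, map_neg h (-x - t • S.center)]
        rw [map_neg] at h1 h2
        constructor
        · intro h'; linarith [h2 (by linarith)]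
        · intro h'; linarith
      rw [hsame]
      refine signedCount_eq_zero_of_exists hf (g := -g) fun p hp => ?_
      have h3 : x + t • S.center = -(-x - t • S.center) := by abel
      rw [h3, map_neg, map_neg, LinearMap.neg_apply, LinearMap.neg_apply]
      linarith [hg p hp]
  · have hx0 : x ≠ 0 := fun h => hxC <| by
      obtain ⟨p, hp, -⟩ := S.exists_vert_forall_le 0
      exact ⟨0, le_rfl, p, vert_subset hp, by rw [h, zero_smul]⟩
    rw [indicator_of_notMem (hint hx.ge), mul_zero]
    obtain ⟨g, hg⟩ : ∃ g : Module.Dual ℝ E, g x ≠ 0 := by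
      by_contra! hcon
      exact hx0 ((Module.forall_dual_apply_eq_zero_iff ℝ x).1 hcon)
    -- As `R x = 0`, only positivity at `x` is required, and the value there is `(g x)^2`.
    refine signedCount_eq_zero_of_exists hf (g := g x • g) fun p hp => ?_
    rw [hx, zero_mul, LinearMap.smul_apply, smul_eq_mul]
    exact mul_self_pos.2 hg
  · rw [indicator_of_notMem (hint hx.le), mul_zero]
    rw [mem_coneOver_iff (S := S) hx] at hxC
    push Not at hxC
    obtain ⟨h, hh, hneg⟩ := hxC
    obtain ⟨g, hg⟩ := exists_lt_of_facet_neg hx hh hneg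
    exact signedCount_eq_zero_of_exists hf hg

end Count

end FacetSystem

/-! ### Polarized cones in facet coordinates. -/

section Cones

variable {E : Type*} [AddCommGroup E] [Module ℝ E] [TopologicalSpace E] {R : Module.Dual ℝ E}
  {P : Set E}

/-- Negation exchanges the sign conditions on the coefficients, and the line through `μ` absorbs the
change of apex from `p` to `-p`. -/
theorem dualLiftedCone_eq_neg {ξ : Module.Dual ℝ (LinearMap.ker R)} {p μ : E}
    (hμ : IsEdgeVector p μ) : dualLiftedCone P ξ p μ = -liftedCone P ξ p μ := by
  obtain ⟨c, hc, rfl⟩ := hμ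
  -- As `μ = c • p`, the shift `2 / c` accounts for the difference `2p` between the apexes.
  have hshift : ∀ t : ℝ, (-t - 2 / c) • c • p = -(t • c • p) - p - p := fun t => by
    rw [smul_smul, smul_smul, sub_mul, div_mul_cancel₀ _ hc.ne', sub_smul, neg_mul, neg_smul,
      two_smul, sub_sub]
  ext x
  rw [Set.mem_neg]
  constructor
  · rintro ⟨y, ⟨a, ha, ha', rfl⟩, t, rfl⟩
    refine ⟨_, ⟨fun w => -a w, fun w hw => neg_lt_zero.2 (ha w hw),
      fun w hw => neg_nonneg.2 (ha' w hw), rfl⟩, -t - 2 / c, ?_⟩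
    simp only [hshift, neg_smul, finsum_neg_distrib]
    abel
  · rintro ⟨y, ⟨a, ha, ha', rfl⟩, t, hx⟩
    refine ⟨_, ⟨fun w => -a w, fun w hw => neg_pos.2 (ha w hw),
      fun w hw => neg_nonpos.2 (ha' w hw), rfl⟩, -t - 2 / c, ?_⟩
    rw [← neg_neg x, hx]
    simp only [hshift, neg_smul, finsum_neg_distrib]
    abel

namespace FacetSystem

open scoped Classical

variable {S : FacetSystem R P} {f : Module.Dual ℝ E} {ξ : Module.Dual ℝ (LinearMap.ker R)}
  {p : E}

theorem edge_mem_ker {w : E} (hp : p ∈ S.vert) (hw : w ∈ S.edge p) : w ∈ LinearMap.ker R := by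
  have h := S.eq_one (vert_subset (add_mem_vert hw))
  rw [map_add, S.eq_one (vert_subset hp)] at h
  rw [LinearMap.mem_ker]
  linarith

theorem isGeneric_of_isPolarizing (hfξ : ∀ w : LinearMap.ker R, f w = ξ w)
    (hξ : IsPolarizing P ξ) : S.IsGeneric f := fun p hp w hw => by
  have := hξ p (S.mem_vert.1 hp) ⟨w, edge_mem_ker hp hw⟩ (S.mem_edge.1 hw)
  rwa [← hfξ] at this

theorem image_edgePlus (hfξ : ∀ w : LinearMap.ker R, f w = ξ w) (hp : p ∈ S.vert) :
    Subtype.val '' edgePlus P ξ p = ((S.edge p).filter fun w => 0 < f w : Finset E) := by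
  ext w
  simp only [mem_image, edgePlus, mem_ofPred_eq, Finset.coe_filter, ← hfξ, ← S.mem_edge]
  constructor
  · rintro ⟨v, hv, rfl⟩
    exact hv
  · exact fun hw => ⟨⟨w, edge_mem_ker hp hw.1⟩, hw, rfl⟩

theorem image_edgeMinus (hfξ : ∀ w : LinearMap.ker R, f w = ξ w) (hp : p ∈ S.vert) :
    Subtype.val '' edgeMinus P ξ p = ((S.edge p).filter fun w => f w < 0 : Finset E) := by
  ext w
  simp only [mem_image, edgeMinus, mem_ofPred_eq, Finset.coe_filter, ← hfξ, ← S.mem_edge]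
  constructor
  · rintro ⟨v, hv, rfl⟩
    exact hv
  · exact fun hw => ⟨⟨w, edge_mem_ker hp hw.1⟩, hw, rfl⟩

theorem vertexSign_eq (hfξ : ∀ w : LinearMap.ker R, f w = ξ w) (hp : p ∈ S.vert) :
    vertexSign P ξ p = (-1) ^ (S.upFacets f p).card := by
  rw [vertexSign, ← Set.ncard_image_of_injective _ Subtype.val_injective, image_edgePlus hfξ hp,
    Set.ncard_coe_finset, upFacets, Finset.card_image_of_injOn]
  exact (normal_injOn hp).mono (Finset.filter_subset _ _)

theorem finsum_edges (hf : S.IsGeneric f) (hfξ : ∀ w : LinearMap.ker R, f w = ξ w)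
    (hp : p ∈ S.vert) (a : E → ℝ) :
    ∑ᶠ w ∈ edgePlus P ξ p, a w • (w : E) + ∑ᶠ w ∈ edgeMinus P ξ p, a w • (w : E) =
      ∑ w ∈ S.edge p, a w • w := by
  rw [← finsum_mem_image (f := fun w => a w • w) (g := Subtype.val)
      Subtype.val_injective.injOn,
    ← finsum_mem_image (f := fun w => a w • w) (g := Subtype.val)
      Subtype.val_injective.injOn,
    image_edgePlus hfξ hp, image_edgeMinus hfξ hp, finsum_mem_coe_finset, finsum_mem_coe_finset,
    ← Finset.sum_filter_add_sum_filter_not (S.edge p) fun w => 0 < f w]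
  congr 2
  refine Finset.filter_congr fun w hw => ?_
  rw [not_lt, le_iff_lt_or_eq]
  exact (or_iff_left (hf p hp w hw)).symm

theorem mem_polarizedCone_iff (hf : S.IsGeneric f) (hfξ : ∀ w : LinearMap.ker R, f w = ξ w)
    (hp : p ∈ S.vert) {x : E} :
    x ∈ polarizedCone P ξ p ↔ ∃ a : E → ℝ, (∀ w ∈ S.edge p, (a w < 0 ↔ 0 < f w)) ∧
      x = p + ∑ w ∈ S.edge p, a w • w := by
  constructor
  · rintro ⟨a, ha, ha', rfl⟩
    let a' : E → ℝ := fun w => if h : w ∈ LinearMap.ker R then a ⟨w, h⟩ else 0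
    have haa' : ∀ w : LinearMap.ker R, a w = a' w := fun w => by
      simp only [a', dif_pos w.2]
    refine ⟨a', fun w hw => ?_, ?_⟩
    · have hw' := edge_mem_ker hp hw
      rw [← haa' ⟨w, hw'⟩]
      rcases lt_or_gt_of_ne (hf p hp w hw) with h | h
      · have := ha' ⟨w, hw'⟩ ⟨S.mem_edge.1 hw, by rwa [← hfξ]⟩
        exact iff_of_false (not_lt.2 this) h.not_gt
      · exact iff_of_true (ha ⟨w, hw'⟩ ⟨S.mem_edge.1 hw, by rwa [← hfξ]⟩) h
    · rw [add_assoc, ← finsum_edges hf hfξ hp]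
      simp only [haa']
  · rintro ⟨a, ha, rfl⟩
    refine ⟨fun w => a w, ?_, ?_, ?_⟩
    · rintro w ⟨hw, hpos⟩
      exact (ha w (S.mem_edge.2 hw)).2 (by rwa [hfξ])
    · rintro w ⟨hw, hneg⟩
      exact not_lt.1 fun h => hneg.not_gt (by
        rw [← hfξ]; exact (ha w (S.mem_edge.2 hw)).1 h)
    · rw [add_assoc, ← finsum_edges hf hfξ hp]

/-- Functionals at `p` vanish on `μ`, so they read off the edge coefficients up to a positive
factor; the coefficient along `μ` is free. -/
theorem mem_liftedCone_iff (hf : S.IsGeneric f) (hfξ : ∀ w : LinearMap.ker R, f w = ξ w)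
    (hp : p ∈ S.vert) {μ : E} (hμ : IsEdgeVector p μ) {x : E} :
    x ∈ liftedCone P ξ p μ ↔ ∀ w ∈ S.edge p, (S.normal p w x < 0 ↔ 0 < f w) := by
  obtain ⟨c, hc, rfl⟩ := hμ
  constructor
  · rintro ⟨y, hy, t, rfl⟩ w hw
    obtain ⟨a, ha, rfl⟩ := (mem_polarizedCone_iff hf hfξ hp).1 hy
    have hval : S.normal p w (p + ∑ u ∈ S.edge p, a u • u + t • c • p) =
        a w * S.normal p w w := by
      rw [map_add, map_add, map_smul, map_smul, S.normal_apply_vert hp hw, map_sum,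
        Finset.sum_eq_single_of_mem w hw]
      · simp
      · intro u hu hne
        rw [map_smul, S.normal_apply_ne hp hw hu hne, smul_zero]
    have hself := S.normal_apply_self hp hw
    rw [hval, ← ha w hw]
    exact ⟨fun h => neg_of_mul_neg_left h hself.le, fun h => mul_neg_of_neg_of_pos h hself⟩
  · intro h
    refine ⟨p + ∑ w ∈ S.edge p, (S.normal p w x / S.normal p w w) • w,
      (mem_polarizedCone_iff hf hfξ hp).2 ⟨_, fun w hw => ?_, rfl⟩, (R x - 1) / c, ?_⟩
    · rw [← h w hw, div_lt_iff₀ (S.normal_apply_self hp hw), zero_mul]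
    · conv_lhs => rw [S.expand hp x]
      rw [smul_smul, div_mul_cancel₀ _ hc.ne', sub_smul, one_smul]
      abel

variable [FiniteDimensional ℝ E] [IsTopologicalAddGroup E] [ContinuousSMul ℝ E] [T2Space E]

/-- The polarized decomposition of the cone over a simple polytope. -/
theorem sum_liftedCone {n : ℕ} (hn : ∀ p ∈ S.vert, (S.edge p).card = n) (hf : S.IsGeneric f)
    (hfξ : ∀ w : LinearMap.ker R, f w = ξ w) {μ : E → E}
    (hμ : ∀ p ∈ S.vert, IsEdgeVector p (μ p)) (x : E) :
    ∑ p ∈ S.vert, vertexSign P ξ p * (liftedCone P ξ p (μ p)).indicator 1 x =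
      (coneOver P).indicator 1 x + (-1) ^ n * (-interior (coneOver P)).indicator 1 x := by
  rw [← signedCount_negFacets hn hf x, signedCount]
  refine Finset.sum_congr rfl fun p hp => ?_
  rw [vertexSign_eq hfξ hp, indicator_apply, mem_liftedCone_iff hf hfξ hp (hμ p hp),
    ← upFacets_eq_iff hp]
  simp

theorem sum_dualLiftedCone {n : ℕ} (hn : ∀ p ∈ S.vert, (S.edge p).card = n)
    (hf : S.IsGeneric f) (hfξ : ∀ w : LinearMap.ker R, f w = ξ w) {μ : E → E}
    (hμ : ∀ p ∈ S.vert, IsEdgeVector p (μ p)) (x : E) :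
    ∑ p ∈ S.vert, vertexSign P ξ p * (dualLiftedCone P ξ p (μ p)).indicator 1 x =
      (-1) ^ n * (interior (coneOver P)).indicator 1 x + (-coneOver P).indicator 1 x := by
  have hneg : ∀ A : Set E, (-A).indicator (1 : E → ℤ) x = A.indicator 1 (-x) := fun A => by
    simp [indicator_apply]
  have h := sum_liftedCone hn hf hfξ hμ (-x)
  rw [hneg, add_comm]
  rw [← hneg (-interior (coneOver P)), neg_neg] at h
  rw [← h]
  refine Finset.sum_congr rfl fun p hp => ?_
  rw [dualLiftedCone_eq_neg (hμ p hp), hneg]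

end FacetSystem

end Cones

end PolarCone

open PolarCone in
theorem mainTheorem4 {E : Type*} [AddCommGroup E] [Module ℝ E] [FiniteDimensional ℝ E]
    [TopologicalSpace E] [IsTopologicalAddGroup E] [ContinuousSMul ℝ E] [T2Space E]
    (n : ℕ) (hn : Module.finrank ℝ E = n + 1)
    (R : Module.Dual ℝ E) (P : Set E) (hP : IsSimplePolytopeOn R n P)
    (ξ : Module.Dual ℝ (LinearMap.ker R)) (hξ : IsPolarizing P ξ)
    (μ : E → E) (hμ : ∀ p ∈ Vert P, IsEdgeVector p (μ p)) :
    (∀ x : E, ∑ᶠ p ∈ Vert P, vertexSign P ξ p * (liftedCone P ξ p (μ p)).indicator 1 x =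
        (coneOver P).indicator 1 x + (-1) ^ n * (-interior (coneOver P)).indicator 1 x) ∧
    (∀ x : E, ∑ᶠ p ∈ Vert P, vertexSign P ξ p * (dualLiftedCone P ξ p (μ p)).indicator 1 x =
        (-1) ^ n * (interior (coneOver P)).indicator 1 x + (-coneOver P).indicator 1 x) ∧
    ∀ b : Module.Basis (Fin (n + 1)) ℝ (Module.Dual ℝ E),
      (∑ᶠ p ∈ Vert P, vertexSign P ξ p • genSeries b (liftedCone P ξ p (μ p)) =
        genSeries b (coneOver P) + (-1 : ℤ) ^ n • genSeries b (-interior (coneOver P))) ∧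
      (∑ᶠ p ∈ Vert P, vertexSign P ξ p • genSeries b (dualLiftedCone P ξ p (μ p)) =
        (-1 : ℤ) ^ n • genSeries b (interior (coneOver P)) + genSeries b (-coneOver P)) := by
  classical
  have := locallyConvexSpace_of_finiteDimensional E
  obtain ⟨S⟩ := hP.nonempty_facetSystem hn
  -- Any extension will do: genericity and signs involve only edge vectors, which lie in `ker R`.
  obtain ⟨f, hf⟩ := LinearMap.exists_extend ξ
  have hfξ : ∀ w : LinearMap.ker R, f w = ξ w := fun w => LinearMap.congr_fun hf w
  have hgen : S.IsGeneric f := FacetSystem.isGeneric_of_isPolarizing hfξ hξ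
  have hcard : ∀ p ∈ S.vert, (S.edge p).card = n := fun p hp => by
    rw [← hP.ncard_edgeVectors p (S.mem_vert.1 hp), ← Set.ncard_coe_finset]
    congr 1
    ext w
    exact S.mem_edge
  have hμ' : ∀ p ∈ S.vert, IsEdgeVector p (μ p) := fun p hp => hμ p (S.mem_vert.1 hp)
  have hvert : Vert P = S.vert := by
    ext p
    exact S.mem_vert.symm
  have h1 := FacetSystem.sum_liftedCone hcard hgen hfξ hμ'
  have h2 := FacetSystem.sum_dualLiftedCone hcard hgen hfξ hμ'
  simp only [hvert, finsum_mem_coe_finset]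
  refine ⟨h1, h2, fun b => ⟨?_, ?_⟩⟩
  · funext ν
    simpa [genSeries, Finset.sum_apply] using h1 ν
  · funext ν
    simpa [genSeries, Finset.sum_apply] using h2 ν
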